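/- **Setting.** All matrices are over $\mathbb F_2$. A CSS code $\mathcal C$ is given by check matrices $H_X\in\mathbb F_2^{m_X\times n}$, $H_Z\in\mathbb F_2^{m_Z\times n}$ with $H_XH_Z^{\mathsf T}=0$; $d_X$ is the least Hamming weight of an element of $\ker H_Z\setminus\operatorname{rs}H_X$ and $d_Z$ that of an element of $\ker H_X\setminus\operatorname{rs}H_Z$ ($\infty$ if there is none). *Product code.* Let $\mathcal C,\mathcal C'$ be CSS codes with matrices $H_X,H_Z$ and $H'_X,H'_Z$. Their homological product code has three sectors of qubits, left ($m_Z\times m_X'$), middle ($n\times n'$), right ($m_X\times m_Z'$), and the checks $$\tilde H_X=\begin{pmatrix}H_Z^{\mathsf T}\otimes 1&1\otimes H'_X&0\\0&H_X\otimes 1&1\otimes H_Z'^{\mathsf T}\end{pmatrix},\qquad \tilde H_Z=\begin{pmatrix}1\otimes H_X'^{\mathsf T}&H_Z\otimes 1&0\\0&1\otimes H'_Z&H_X^{\mathsf T}\otimes 1\end{pmatrix}.$$ The middle-sector code is the subsystem code in which all logical qubits other than those of $\mathcal H^0(\mathcal C)\otimes\mathcal H^0(\mathcal C')$ (with $\mathcal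 H^0(\mathcal C)=\ker H_Z/\operatorname{rs}H_X$) are gauge qubits. Its $X$ gauge operators are spanned by $a\otimes b$ on the left sector with $H_X'^{\mathsf T}b=0$ and $a\otimes b$ on the right sector with $H_X^{\mathsf T}a=0$; its $Z$ gauge operators by $a\otimes b$ on the left with $H_Z^{\mathsf T}a=0$ and $a\otimes b$ on the right with $H_Z'^{\mathsf T}b=0$. A nontrivial dressed logical $X$ operator is an element of $\ker\tilde H_Z$ that is not a sum of an element of $\operatorname{rs}\tilde H_X$ and an $X$ gauge operator; similarly for $Z$. *Gadgets.* A gadget of $\mathcal C$ consists of invertible matrices $U,W,\hat W$ with $H_XU=WH_X$ and $H_ZU^{-\mathsf T}=\hat WH_Z$, together with circuits that implement $U$, $W$ and $\hat W^{-\mathsf T}$ on $X$-type Paulis (row vectors, $x\mapsto xU$; $Z$-type Paulis transform by the inverse transpose). A circuit is a finite sequence of time steps, each a qubit permutation followed by a layer of gates on disjoint sets of qubits (CNOT-type gates, which map $X$-type to $X$-type and $Z$-type to $Z$-type Paulis; idling is a one-qubit gate), followed by a last permutation. From gadgets $(U_1,W_1,\hat W_1)$ of $\mathcal C$ and $(U_2,W_2,\hat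 W_2)$ of $\mathcal C'$ the product code inherits $$\tilde U_1=(\hat W_1^{-\mathsf T}\otimes 1)\oplus(U_1\otimes 1)\oplus(W_1\otimes 1),\qquad \tilde U_2=(1\otimes W_2)\oplus(1\otimes U_2)\oplus(1\otimes\hat W_2^{-\mathsf T}),$$ where in each sector the given circuit is run in parallel on all columns (for $\tilde U_1$) or all rows (for $\tilde U_2$), the three sectors run in parallel, and a sector that has finished idles until the others have. *Noise.* Permutations are noise-free. An elementary fault is a Pauli error on one incoming qubit, or an arbitrary Pauli error on the qubits of one gate (or idling qubit) of one layer, occurring after that layer; faults propagate through the rest of the circuit. The $X$ (resp. $Z$) fault distance of a circuit with respect to a code is the least number of elementary faults for which the $X$-part (resp. $Z$-part) of the output error is a nontrivial (dressed) logical $X$ (resp. $Z$) operator. A gadget of $\mathcal C$ is distance-preserving if the $X$ and $Z$ fault distances of its circuit for $U$ are at least $d_X$ and $d_Z$. **Theorem.** Let $\mathcal C,\mathcal C'$ be CSS codes with distances $(d_X,d_Z)$ and $(d'_X,d'_Z)$, each with a distance-preserving gadget. Then both inherited gadgets $\tilde U_1$ and $\tilde U_2$ have, with respect to the middle-sector homological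 product code of $\mathcal C$ and $\mathcal C'$, $X$ fault distance at least $\max(d_X,d'_X)$ and $Z$ fault distance at least $\max(d_Z,d'_Z)$. -/

import Mathlib

namespace HomologicalProduct

open Matrix
open scoped Kronecker

/-! ### CSS codes, CSS subsystem codes and their distances -/

/-- A CSS code, with qubits labelled by `Q`, `X`-checks by `X` and `Z`-checks by `Z`; the rows of
`HX` and `HZ` are the supports of the `X`-type and `Z`-type parity checks, which commute. -/
structure CSSCode (X Q Z : Type*) [Fintype Q] where
  HX : Matrix X Q (ZMod 2)
  HZ : Matrix Z Q (ZMod 2)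
  css : HX * HZᵀ = 0

/-- The row space of a binary matrix. -/
def rowSpace {R Q : Type*} (H : Matrix R Q (ZMod 2)) : Submodule (ZMod 2) (Q → ZMod 2) :=
  Submodule.span (ZMod 2) (Set.range H.row)

/-- A CSS subsystem code: a CSS code in which some of the logical qubits are designated as gauge
qubits. `gaugeX` and `gaugeZ` contain the supports of the logical operators of those gauge qubits;
they need not contain the stabilizers. -/
structure CSSSubsystemCode (X Q Z : Type*) [Fintype Q] extends CSSCode X Q Z where
  gaugeX : Submodule (ZMod 2) (Q → ZMod 2)
  gaugeZ : Submodule (ZMod 2) (Q → ZMod 2)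
  gaugeX_undetected : ∀ x ∈ gaugeX, HZ *ᵥ x = 0
  gaugeZ_undetected : ∀ z ∈ gaugeZ, HX *ᵥ z = 0

/-- A CSS code without gauge qubits. -/
def CSSCode.noGauge {X Q Z : Type*} [Fintype Q] (C : CSSCode X Q Z) : CSSSubsystemCode X Q Z where
  toCSSCode := C
  gaugeX := ⊥
  gaugeZ := ⊥
  gaugeX_undetected := by simp
  gaugeZ_undetected := by simp

section Distances

variable {X Q Z : Type*} [Fintype Q]

/-- `x` is the support of a nontrivial (dressed) logical `X` operator: it is not detected by the
`Z`-checks and it is not a product of `X`-stabilizers and `X`-type gauge operators. -/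
def CSSSubsystemCode.IsLogicalX (K : CSSSubsystemCode X Q Z) (x : Q → ZMod 2) : Prop :=
  K.HZ *ᵥ x = 0 ∧ x ∉ rowSpace K.HX ⊔ K.gaugeX

/-- `z` is the support of a nontrivial (dressed) logical `Z` operator. -/
def CSSSubsystemCode.IsLogicalZ (K : CSSSubsystemCode X Q Z) (z : Q → ZMod 2) : Prop :=
  K.HX *ᵥ z = 0 ∧ z ∉ rowSpace K.HZ ⊔ K.gaugeZ

/-- The `X` distance `d_X` of a CSS code: the least weight of an element of `ker HZ` outside
`rs HX` (`⊤` if there is none, that is, if there are no logical qubits). -/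
noncomputable def CSSCode.distX (C : CSSCode X Q Z) : ℕ∞ :=
  ⨅ (x : Q → ZMod 2) (_ : C.noGauge.IsLogicalX x), (hammingNorm x : ℕ∞)

/-- The `Z` distance `d_Z` of a CSS code. -/
noncomputable def CSSCode.distZ (C : CSSCode X Q Z) : ℕ∞ :=
  ⨅ (z : Q → ZMod 2) (_ : C.noGauge.IsLogicalZ z), (hammingNorm z : ℕ∞)

end Distances

/-! ### Circuits of noise-free permutations and noisy CNOT-type gates -/

/-- One layer of gates acting simultaneously on disjoint sets of qubits. Two qubits take part in the
same gate iff they have the same label `gate`; an idling qubit is a gate on a single qubit. The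
gates are those which map `X`-type Paulis to `X`-type and `Z`-type Paulis to `Z`-type (such as
CNOT): the layer acts on `X`-type Paulis, written as row vectors, by `x ↦ x A` with the
invertible matrix `A = mat`, and on `Z`-type Paulis by `z ↦ z A⁻ᵀ`. -/
structure GateLayer (ι : Type*) [Fintype ι] [DecidableEq ι] where
  gate : ι → ι
  mat : Matrix.GeneralLinearGroup ι (ZMod 2)
  mat_apply_eq_zero : ∀ i j, gate i ≠ gate j → (mat : Matrix ι ι (ZMod 2)) i j = 0

/-- One time step: a noise-free permutation of the qubits (qubit `i` is moved to `perm i`), followed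
by a layer of noisy gates. -/
structure TimeStep (ι : Type*) [Fintype ι] [DecidableEq ι] where
  perm : Equiv.Perm ι
  gates : GateLayer ι

/-- A circuit: finitely many time steps, followed by a last noise-free permutation. -/
structure Circuit (ι : Type*) [Fintype ι] [DecidableEq ι] where
  depth : ℕ
  step : Fin depth → TimeStep ι
  finalPerm : Equiv.Perm ι

/-- A Pauli operator up to phase: its `X`-support and its `Z`-support. -/
abbrev Pauli (ι : Type*) : Type _ := (ι → ZMod 2) × (ι → ZMod 2)

section Circuits

variable {ι κ : Type*} [Fintype ι] [DecidableEq ι] [Fintype κ] [DecidableEq κ]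

/-- All qubits are idle. -/
def TimeStep.idle : TimeStep ι where
  perm := 1
  gates :=
    { gate := id
      mat := 1
      mat_apply_eq_zero := fun _ _ h => Matrix.one_apply_ne h }

/-- The action of a time step on `X`-type Paulis (row vectors). -/
def TimeStep.xMat (s : TimeStep ι) : Matrix ι ι (ZMod 2) :=
  s.perm.permMatrix (ZMod 2) * (s.gates.mat : Matrix ι ι (ZMod 2))

/-- The action of a time step on `Z`-type Paulis (row vectors). -/
def TimeStep.zMat (s : TimeStep ι) : Matrix ι ι (ZMod 2) :=
  s.perm.permMatrix (ZMod 2) * ((s.gates.mat⁻¹ : Matrix.GeneralLinearGroup ι (ZMod 2)) :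
    Matrix ι ι (ZMod 2))ᵀ

/-- The number of gates (including idling qubits) of a layer on which the Pauli operator `e` acts
nontrivially, i.e. the least number of elementary faults of the layer, each of them an arbitrary
Pauli operator on the qubits of a single gate, that together produce `e`. -/
def GateLayer.faultCount (g : GateLayer ι) (e : Pauli ι) : ℕ :=
  ((Finset.univ.filter fun i => e.1 i ≠ 0 ∨ e.2 i ≠ 0).image g.gate).card

/-- The `t`-th time step; after the end of the circuit the qubits are idle. -/
def Circuit.stepAt (Γ : Circuit ι) (t : ℕ) : TimeStep ι :=
  if h : t < Γ.depth then Γ.step ⟨t, h⟩ else TimeStep.idle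

/-- The action on `X`-type Paulis of the first `t` time steps. -/
def Circuit.partialMat (Γ : Circuit ι) : ℕ → Matrix ι ι (ZMod 2)
  | 0 => 1
  | t + 1 => Γ.partialMat t * (Γ.stepAt t).xMat

/-- The action `U` of a circuit on `X`-type Paulis (row vectors `x ↦ x U`). -/
def Circuit.mat (Γ : Circuit ι) : Matrix ι ι (ZMod 2) :=
  Γ.partialMat Γ.depth * Γ.finalPerm.permMatrix (ZMod 2)

/-- The error present after the first `t` time steps (before the last permutation), if the Pauli
error `f 0` is present on the incoming qubits and the Pauli error `f (s + 1)` occurs together with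
the gates of the `s`-th time step. -/
def Circuit.errorAt (Γ : Circuit ι) (f : ℕ → Pauli ι) : ℕ → Pauli ι
  | 0 => f 0
  | t + 1 => ((Γ.errorAt f t).1 ᵥ* (Γ.stepAt t).xMat + (f (t + 1)).1,
      (Γ.errorAt f t).2 ᵥ* (Γ.stepAt t).zMat + (f (t + 1)).2)

/-- The error at the output of the circuit caused by the faults `f`. -/
def Circuit.outputError (Γ : Circuit ι) (f : ℕ → Pauli ι) : Pauli ι :=
  ((Γ.errorAt f Γ.depth).1 ᵥ* Γ.finalPerm.permMatrix (ZMod 2),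
    (Γ.errorAt f Γ.depth).2 ᵥ* Γ.finalPerm.permMatrix (ZMod 2))

/-- The number of elementary faults in `f`: faulty incoming qubits and faulty gates. Permutations
do not fail. -/
def Circuit.faultCount (Γ : Circuit ι) (f : ℕ → Pauli ι) : ℕ :=
  (TimeStep.idle (ι := ι)).gates.faultCount (f 0) +
    ∑ t ∈ Finset.range Γ.depth, (Γ.stepAt t).gates.faultCount (f (t + 1))

/-- The `X` fault distance of a circuit acting on the qubits of a code: the least number of
elementary faults after which the `X`-part of the error at the output is a nontrivial (dressed)
logical `X` operator (`⊤` if this cannot happen). -/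
noncomputable def Circuit.faultDistX {X Z : Type*} (Γ : Circuit ι)
    (K : CSSSubsystemCode X ι Z) : ℕ∞ :=
  ⨅ (f : ℕ → Pauli ι) (_ : K.IsLogicalX (Γ.outputError f).1), (Γ.faultCount f : ℕ∞)

/-- The `Z` fault distance of a circuit acting on the qubits of a code. -/
noncomputable def Circuit.faultDistZ {X Z : Type*} (Γ : Circuit ι)
    (K : CSSSubsystemCode X ι Z) : ℕ∞ :=
  ⨅ (f : ℕ → Pauli ι) (_ : K.IsLogicalZ (Γ.outputError f).2), (Γ.faultCount f : ℕ∞)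

/-! ### Parallel composition of circuits -/

/-- `A ⊗ B` for invertible matrices. -/
def kronGL (A : Matrix.GeneralLinearGroup ι (ZMod 2)) (B : Matrix.GeneralLinearGroup κ (ZMod 2)) :
    Matrix.GeneralLinearGroup (ι × κ) (ZMod 2) where
  val := (A : Matrix ι ι (ZMod 2)) ⊗ₖ (B : Matrix κ κ (ZMod 2))
  inv := ((A⁻¹ : Matrix.GeneralLinearGroup ι (ZMod 2)) : Matrix ι ι (ZMod 2)) ⊗ₖ
    ((B⁻¹ : Matrix.GeneralLinearGroup κ (ZMod 2)) : Matrix κ κ (ZMod 2))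
  val_inv := by
    rw [← Matrix.mul_kronecker_mul, Units.mul_inv, Units.mul_inv, Matrix.one_kronecker_one]
  inv_val := by
    rw [← Matrix.mul_kronecker_mul, Units.inv_mul, Units.inv_mul, Matrix.one_kronecker_one]

/-- `A ⊕ B` for invertible matrices. -/
def directSumGL (A : Matrix.GeneralLinearGroup ι (ZMod 2))
    (B : Matrix.GeneralLinearGroup κ (ZMod 2)) : Matrix.GeneralLinearGroup (ι ⊕ κ) (ZMod 2) where
  val := Matrix.fromBlocks (A : Matrix ι ι (ZMod 2)) 0 0 (B : Matrix κ κ (ZMod 2))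
  inv := Matrix.fromBlocks
    ((A⁻¹ : Matrix.GeneralLinearGroup ι (ZMod 2)) : Matrix ι ι (ZMod 2)) 0 0
    ((B⁻¹ : Matrix.GeneralLinearGroup κ (ZMod 2)) : Matrix κ κ (ZMod 2))
  val_inv := by
    rw [Matrix.fromBlocks_multiply]
    simp [← Units.val_mul, -Matrix.coe_units_inv]
  inv_val := by
    rw [Matrix.fromBlocks_multiply]
    simp [← Units.val_mul, -Matrix.coe_units_inv]

/-- The time step `s`, carried out on each of the columns of an `ι × κ` grid in parallel. -/
def TimeStep.onColumns (κ : Type*) [Fintype κ] [DecidableEq κ] (s : TimeStep ι) :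
    TimeStep (ι × κ) where
  perm := Equiv.prodCongr s.perm (Equiv.refl κ)
  gates :=
    { gate := fun p => (s.gates.gate p.1, p.2)
      mat := kronGL s.gates.mat 1
      mat_apply_eq_zero := by
        rintro ⟨i, c⟩ ⟨j, d⟩ h
        by_cases hcd : c = d
        · subst hcd
          have : s.gates.gate i ≠ s.gates.gate j := fun h' => h (by simp [h'])
          simp [kronGL, s.gates.mat_apply_eq_zero i j this]
        · simp [kronGL, hcd] }

/-- The time step `s`, carried out on each of the rows of a `κ × ι` grid in parallel. -/
def TimeStep.onRows (κ : Type*) [Fintype κ] [DecidableEq κ] (s : TimeStep ι) :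
    TimeStep (κ × ι) where
  perm := Equiv.prodCongr (Equiv.refl κ) s.perm
  gates :=
    { gate := fun p => (p.1, s.gates.gate p.2)
      mat := kronGL 1 s.gates.mat
      mat_apply_eq_zero := by
        rintro ⟨c, i⟩ ⟨d, j⟩ h
        by_cases hcd : c = d
        · subst hcd
          have : s.gates.gate i ≠ s.gates.gate j := fun h' => h (by simp [h'])
          simp [kronGL, s.gates.mat_apply_eq_zero i j this]
        · simp [kronGL, hcd] }

/-- Two time steps, carried out simultaneously on disjoint sets of qubits. -/
def TimeStep.par (s : TimeStep ι) (t : TimeStep κ) : TimeStep (ι ⊕ κ) where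
  perm := Equiv.sumCongr s.perm t.perm
  gates :=
    { gate := Sum.map s.gates.gate t.gates.gate
      mat := directSumGL s.gates.mat t.gates.mat
      mat_apply_eq_zero := by
        rintro (i | i) (j | j) h
        · exact s.gates.mat_apply_eq_zero i j fun h' => h (by simp [h'])
        · rfl
        · rfl
        · exact t.gates.mat_apply_eq_zero i j fun h' => h (by simp [h']) }

/-- The circuit `Γ`, run on each of the columns of an `ι × κ` grid in parallel. -/
def Circuit.onColumns (κ : Type*) [Fintype κ] [DecidableEq κ] (Γ : Circuit ι) :
    Circuit (ι × κ) where
  depth := Γ.depth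
  step t := (Γ.step t).onColumns κ
  finalPerm := Equiv.prodCongr Γ.finalPerm (Equiv.refl κ)

/-- The circuit `Γ`, run on each of the rows of a `κ × ι` grid in parallel. -/
def Circuit.onRows (κ : Type*) [Fintype κ] [DecidableEq κ] (Γ : Circuit ι) :
    Circuit (κ × ι) where
  depth := Γ.depth
  step t := (Γ.step t).onRows κ
  finalPerm := Equiv.prodCongr (Equiv.refl κ) Γ.finalPerm

/-- Two circuits, run in parallel on disjoint sets of qubits. The qubits of the shorter circuit idle
(and may fail) until the longer one is finished. -/
def Circuit.par (Γ : Circuit ι) (Δ : Circuit κ) : Circuit (ι ⊕ κ) where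
  depth := max Γ.depth Δ.depth
  step t := (Γ.stepAt t).par (Δ.stepAt t)
  finalPerm := Equiv.sumCongr Γ.finalPerm Δ.finalPerm

end Circuits

/-! ### The middle-sector homological product code -/

section Product

variable {X Q Z X' Q' Z' : Type*}
  [Fintype X] [Fintype Q] [Fintype Z] [Fintype X'] [Fintype Q'] [Fintype Z']
  [DecidableEq X] [DecidableEq Q] [DecidableEq Z]
  [DecidableEq X'] [DecidableEq Q'] [DecidableEq Z']

/-- The (quantum × quantum) homological product code. Its qubits form the left sector `Z × X'`, the
middle sector `Q × Q'` and the right sector `X × Z'`. -/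
def CSSCode.homProduct (C : CSSCode X Q Z) (C' : CSSCode X' Q' Z') :
    CSSCode (Q × X' ⊕ X × Q') (Z × X' ⊕ (Q × Q' ⊕ X × Z')) (Z × Q' ⊕ Q × Z') where
  HX := Matrix.fromRows
    (Matrix.fromCols (C.HZᵀ ⊗ₖ (1 : Matrix X' X' (ZMod 2)))
      (Matrix.fromCols ((1 : Matrix Q Q (ZMod 2)) ⊗ₖ C'.HX) 0))
    (Matrix.fromCols 0
      (Matrix.fromCols (C.HX ⊗ₖ (1 : Matrix Q' Q' (ZMod 2)))
        ((1 : Matrix X X (ZMod 2)) ⊗ₖ C'.HZᵀ)))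
  HZ := Matrix.fromRows
    (Matrix.fromCols ((1 : Matrix Z Z (ZMod 2)) ⊗ₖ C'.HXᵀ)
      (Matrix.fromCols (C.HZ ⊗ₖ (1 : Matrix Q' Q' (ZMod 2))) 0))
    (Matrix.fromCols 0
      (Matrix.fromCols ((1 : Matrix Q Q (ZMod 2)) ⊗ₖ C'.HZ)
        (C.HXᵀ ⊗ₖ (1 : Matrix Z' Z' (ZMod 2)))))
  css := by
    simp only [Matrix.transpose_fromRows, Matrix.transpose_fromCols, Matrix.fromRows_mul,
      Matrix.mul_fromCols, Matrix.fromCols_mul_fromRows, ← Matrix.kroneckerMap_transpose,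
      Matrix.transpose_zero, Matrix.transpose_one, Matrix.transpose_transpose,
      ← Matrix.mul_kronecker_mul, Matrix.one_mul, Matrix.mul_one, Matrix.zero_mul, Matrix.mul_zero,
      zero_add, add_zero, C.css, C'.css, Matrix.zero_kronecker, Matrix.kronecker_zero]
    ext (i | i) (j | j)
    · exact CharTwo.add_self_eq_zero _
    · rfl
    · rfl
    · exact CharTwo.add_self_eq_zero _

/-- `a ⊗ b`, placed on the left sector. -/
def leftVec (a : Z → ZMod 2) (b : X' → ZMod 2) : Z × X' ⊕ (Q × Q' ⊕ X × Z') → ZMod 2 :=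
  Sum.elim (fun p => a p.1 * b p.2) 0

/-- `a ⊗ b`, placed on the right sector. -/
def rightVec (a : X → ZMod 2) (b : Z' → ZMod 2) : Z × X' ⊕ (Q × Q' ⊕ X × Z') → ZMod 2 :=
  Sum.elim 0 (Sum.elim 0 fun p => a p.1 * b p.2)

/-- The `X`-type gauge operators: products `a ⊗ b` of an `i`-cocycle of `C` and a `(-i)`-cocycle of
`C'` for `i = 1` (left sector) and `i = -1` (right sector). Together with the stabilizers they
generate the spurious cohomology `H^i(C) ⊗ H^{-i}(C')`, `i ≠ 0`. Every vector over the
`Z`-checks is a `1`-cocycle, and the `(-1)`-cocycles are the kernel of the transpose of `HX`. -/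
def spuriousX (C : CSSCode X Q Z) (C' : CSSCode X' Q' Z') :
    Submodule (ZMod 2) (Z × X' ⊕ (Q × Q' ⊕ X × Z') → ZMod 2) :=
  Submodule.span (ZMod 2)
    ({v | ∃ a b, C'.HXᵀ *ᵥ b = 0 ∧ v = leftVec a b} ∪
      {v | ∃ a b, C.HXᵀ *ᵥ a = 0 ∧ v = rightVec a b})

/-- The `Z`-type gauge operators: products `a ⊗ b` of an `i`-cycle of `C` and a `(-i)`-cycle of `C'`
for `i = 1` (left sector) and `i = -1` (right sector). Together with the stabilizers they
generate the spurious homology `H_i(C) ⊗ H_{-i}(C')`, `i ≠ 0`. The `1`-cycles are the kernel of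
the transpose of `HZ`, and every vector over the `X`-checks is a `(-1)`-cycle. -/
def spuriousZ (C : CSSCode X Q Z) (C' : CSSCode X' Q' Z') :
    Submodule (ZMod 2) (Z × X' ⊕ (Q × Q' ⊕ X × Z') → ZMod 2) :=
  Submodule.span (ZMod 2)
    ({v | ∃ a b, C.HZᵀ *ᵥ a = 0 ∧ v = leftVec a b} ∪
      {v | ∃ a b, C'.HZᵀ *ᵥ b = 0 ∧ v = rightVec a b})

theorem kronecker_mulVec_tmul {α β γ δ : Type*} [Fintype β] [Fintype δ]
    (A : Matrix α β (ZMod 2)) (B : Matrix γ δ (ZMod 2)) (a : β → ZMod 2) (b : δ → ZMod 2) :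
    ((A ⊗ₖ B) *ᵥ fun p : β × δ => a p.1 * b p.2) = fun p => (A *ᵥ a) p.1 * (B *ᵥ b) p.2 := by
  ext ⟨i, j⟩
  simp only [Matrix.mulVec, dotProduct, Matrix.kroneckerMap_apply, Fintype.sum_prod_type,
    Finset.sum_mul_sum]
  exact Finset.sum_congr rfl fun _ _ => Finset.sum_congr rfl fun _ _ => by ring

/-- The middle-sector homological product code: only the logical qubits in `H^0(C) ⊗ H^0(C')` are
kept, all the others are gauge qubits. -/
def CSSCode.middleSector (C : CSSCode X Q Z) (C' : CSSCode X' Q' Z') :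
    CSSSubsystemCode (Q × X' ⊕ X × Q') (Z × X' ⊕ (Q × Q' ⊕ X × Z')) (Z × Q' ⊕ Q × Z') where
  toCSSCode := C.homProduct C'
  gaugeX := spuriousX C C'
  gaugeZ := spuriousZ C C'
  gaugeX_undetected := by
    have h : spuriousX C C' ≤ LinearMap.ker (C.homProduct C').HZ.mulVecLin := by
      refine Submodule.span_le.2 ?_
      rintro v (⟨a, b, h, rfl⟩ | ⟨a, b, h, rfl⟩) <;>
      · simp only [leftVec, rightVec, CSSCode.homProduct, SetLike.mem_coe, LinearMap.mem_ker,
          Matrix.mulVecLin_apply, Matrix.fromRows_mulVec, Matrix.fromCols_mulVec_sumElim,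
          kronecker_mulVec_tmul, h, Matrix.mulVec_zero, Matrix.zero_mulVec, add_zero, zero_add]
        ext (i | i) <;> simp
    exact fun x hx => h hx
  gaugeZ_undetected := by
    have h : spuriousZ C C' ≤ LinearMap.ker (C.homProduct C').HX.mulVecLin := by
      refine Submodule.span_le.2 ?_
      rintro v (⟨a, b, h, rfl⟩ | ⟨a, b, h, rfl⟩) <;>
      · simp only [leftVec, rightVec, CSSCode.homProduct, SetLike.mem_coe, LinearMap.mem_ker,
          Matrix.mulVecLin_apply, Matrix.fromRows_mulVec, Matrix.fromCols_mulVec_sumElim,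
          kronecker_mulVec_tmul, h, Matrix.mulVec_zero, Matrix.zero_mulVec, add_zero, zero_add]
        ext (i | i) <;> simp
    exact fun x hx => h hx

/-! ### Input gadgets and inherited gadgets -/

/-- A logical gadget of a CSS code: invertible matrices with `HX U = W HX` and
`HZ U⁻ᵀ = What HZ`, and circuits for `U` (on the qubits of the code), `W` and `Whatᵀ⁻¹`
(on as many qubits as there are `X`-checks and `Z`-checks respectively). -/
structure Gadget (C : CSSCode X Q Z) where
  U : Matrix.GeneralLinearGroup Q (ZMod 2)
  W : Matrix.GeneralLinearGroup X (ZMod 2)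
  What : Matrix.GeneralLinearGroup Z (ZMod 2)
  HX_mul : C.HX * (U : Matrix Q Q (ZMod 2)) = (W : Matrix X X (ZMod 2)) * C.HX
  HZ_mul : C.HZ * ((U⁻¹ : Matrix.GeneralLinearGroup Q (ZMod 2)) : Matrix Q Q (ZMod 2))ᵀ =
    (What : Matrix Z Z (ZMod 2)) * C.HZ
  circuitU : Circuit Q
  circuitW : Circuit X
  circuitWhat : Circuit Z
  circuitU_mat : circuitU.mat = (U : Matrix Q Q (ZMod 2))
  circuitW_mat : circuitW.mat = (W : Matrix X X (ZMod 2))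
  circuitWhat_mat : circuitWhat.mat =
    ((What⁻¹ : Matrix.GeneralLinearGroup Z (ZMod 2)) : Matrix Z Z (ZMod 2))ᵀ

/-- The gadget is distance-preserving: its `X` and `Z` fault distances are not below the `X` and `Z`
distances of the code. -/
def Gadget.DistancePreserving {C : CSSCode X Q Z} (G : Gadget C) : Prop :=
  C.distX ≤ G.circuitU.faultDistX C.noGauge ∧ C.distZ ≤ G.circuitU.faultDistZ C.noGauge

/-- The gadget `(What⁻ᵀ ⊗ 1) ⊕ (U ⊗ 1) ⊕ (W ⊗ 1)` of the homological product code which is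
inherited from a gadget of the first code. -/
def Gadget.inheritFirst {C : CSSCode X Q Z} (G : Gadget C) (X' Q' Z' : Type*)
    [Fintype X'] [Fintype Q'] [Fintype Z'] [DecidableEq X'] [DecidableEq Q'] [DecidableEq Z'] :
    Circuit (Z × X' ⊕ (Q × Q' ⊕ X × Z')) :=
  (G.circuitWhat.onColumns X').par ((G.circuitU.onColumns Q').par (G.circuitW.onColumns Z'))

/-- The gadget `(1 ⊗ W) ⊕ (1 ⊗ U) ⊕ (1 ⊗ What⁻ᵀ)` of the homological product code which is
inherited from a gadget of the second code, on the same three sectors. -/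
def Gadget.inheritSecond {C' : CSSCode X' Q' Z'} (G : Gadget C') (X Q Z : Type*)
    [Fintype X] [Fintype Q] [Fintype Z] [DecidableEq X] [DecidableEq Q] [DecidableEq Z] :
    Circuit (Z × X' ⊕ (Q × Q' ⊕ X × Z')) :=
  (G.circuitW.onRows Z).par ((G.circuitU.onRows Q).par (G.circuitWhat.onRows X))

end Product

end HomologicalProduct

open HomologicalProduct

/-!
The idea is to contract the middle sector of an output error with a logical operator of one of the
two codes; the outer sectors then drop out.

*Contraction.* Let `e` be a nontrivial dressed logical `X` operator of the product code, with middle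
sector `M`. By the Künneth argument of `sector_pairing_eq_zero`, `M` pairs nontrivially with a
product `z ⊗ z'` of `z ∈ ker HX` and `z' ∈ ker HX'`. Indeed some cycle `w` of the product complex
is orthogonal to the stabilizers and gauge operators but not to `e`; orthogonality to the gauge
operators makes the outer parts of `w` bounding, so `w` is homologous to an element of
`ker HX ⊗ ker HX'` on the middle sector. Then `M z'` is a nontrivial logical `X` operator of the
first code: the checks on `e` show that it is undetected (as `HX' z' = 0` removes the contribution
of the outer sectors), and it pairs nontrivially with `z`. Likewise `Mᵀ z` is one of the second
code (`CSSSubsystemCode.IsLogicalX.exists_contraction`, and its `Z` version by transposing the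
grid).

*Faults.* Suppose that a gadget of the first code runs on all columns. Contraction with the fixed
vector `z'` commutes with the circuit, so it maps the faults to faults of a single copy of the
gadget with output `M z'`, without increasing their number: a gate of the single copy is faulty only
if one of its parallel copies is. As the single copy is distance-preserving, there are at least
`d_X` faults. Idling after the end of a sector's circuit does not help, since such faults can be
attributed to the last layer (`Circuit.ProjectsTo.exists_outputError_eq`). On the other hand no
fault leaves its column, so the number of faults is at least the number of faulty columns, hence at
least the weight of `Mᵀ z`, hence at least `d'_X`
(`Circuit.card_faultyColumns_outputError_le`). The gadget of the second code is treated by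
transposing the grid.
-/

namespace HomologicalProduct

open Matrix
open scoped Kronecker

/-! ### Separation by a vector -/

section Separation

variable {ι κ : Type*} [Fintype ι] [Fintype κ]

theorem exists_dotProduct_ne_zero_of_notMem [DecidableEq ι] {S : Submodule (ZMod 2) (ι → ZMod 2)}
    {e : ι → ZMod 2} (he : e ∉ S) : ∃ w, (∀ s ∈ S, s ⬝ᵥ w = 0) ∧ e ⬝ᵥ w ≠ 0 := by
  obtain ⟨φ, hφe, hφ⟩ := Submodule.exists_le_ker_of_notMem he
  obtain ⟨w, rfl⟩ := (dotProductEquiv (ZMod 2) ι).surjective φ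
  refine ⟨w, fun s hs => ?_, ?_⟩
  · simpa [dotProduct_comm] using hφ hs
  · simpa [dotProduct_comm] using hφe

theorem mem_rowSpace_dotProduct_eq_zero {R : Type*} {H : Matrix R ι (ZMod 2)}
    {s z : ι → ZMod 2} (hs : s ∈ rowSpace H) (hz : H *ᵥ z = 0) : s ⬝ᵥ z = 0 := by
  induction hs using Submodule.span_induction with
  | mem x hx => obtain ⟨i, rfl⟩ := hx; exact congrFun hz i
  | zero => exact zero_dotProduct z
  | add x y _ _ hx hy => rw [add_dotProduct, hx, hy, add_zero]
  | smul a x _ hx => rw [smul_dotProduct, hx, smul_zero]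

theorem mulVec_eq_zero_of_rowSpace {R ι : Type*} [Fintype ι] {H : Matrix R ι (ZMod 2)}
    {w : ι → ZMod 2} (h : ∀ s ∈ rowSpace H, s ⬝ᵥ w = 0) : H *ᵥ w = 0 :=
  funext fun i => h _ (Submodule.subset_span ⟨i, rfl⟩)

theorem exists_mulVec_eq_of_forall_dotProduct_eq_zero [DecidableEq ι] [DecidableEq κ]
    (B : Matrix ι κ (ZMod 2))
    {w : ι → ZMod 2} (h : ∀ b, Bᵀ *ᵥ b = 0 → w ⬝ᵥ b = 0) : ∃ u, B *ᵥ u = w := by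
  by_contra hw
  obtain ⟨b, hb, hwb⟩ := exists_dotProduct_ne_zero_of_notMem
    (S := LinearMap.range B.mulVecLin) (e := w) (by simpa using hw)
  refine hwb (h b ?_)
  ext j
  have := hb (B *ᵥ Pi.single j 1) ⟨_, rfl⟩
  rwa [mulVec_single_one] at this

/-- A square matrix which projects onto the kernel of `B`. -/
theorem exists_ker_projection {ι : Type*} [DecidableEq κ] (B : Matrix ι κ (ZMod 2)) :
    ∃ P : Matrix κ κ (ZMod 2), B * P = 0 ∧ ∀ z, B *ᵥ z = 0 → P *ᵥ z = z := by
  obtain ⟨g, hg⟩ := (LinearMap.ker B.mulVecLin).subtype.exists_leftInverse_of_injective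
    (Submodule.ker_subtype _)
  let p : (κ → ZMod 2) →ₗ[ZMod 2] (κ → ZMod 2) := (LinearMap.ker B.mulVecLin).subtype ∘ₗ g
  have hp : ∀ z, LinearMap.toMatrix' p *ᵥ z = p z := fun z => by
    rw [← Matrix.toLin'_apply, Matrix.toLin'_toMatrix']
  refine ⟨LinearMap.toMatrix' p, ?_, fun z hz => ?_⟩
  · refine Matrix.ext_of_mulVec_single fun j => ?_
    rw [← mulVec_mulVec, hp, zero_mulVec]
    exact (g (Pi.single j 1)).2
  · rw [hp]
    exact congrArg Subtype.val (LinearMap.congr_fun hg ⟨z, hz⟩)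

end Separation

/-! ### The Künneth argument -/

section Kunneth

variable {X Q Z X' Q' Z' : Type*}

/-- The left sector of a vector, as a matrix. -/
def leftSector (e : Z × X' ⊕ (Q × Q' ⊕ X × Z') → ZMod 2) : Matrix Z X' (ZMod 2) :=
  Matrix.of fun i j => e (Sum.inl (i, j))

/-- The middle sector of a vector, as a matrix. -/
def midSector (e : Z × X' ⊕ (Q × Q' ⊕ X × Z') → ZMod 2) : Matrix Q Q' (ZMod 2) :=
  Matrix.of fun i j => e (Sum.inr (Sum.inl (i, j)))

/-- The right sector of a vector, as a matrix. -/
def rightSector (e : Z × X' ⊕ (Q × Q' ⊕ X × Z') → ZMod 2) : Matrix X Z' (ZMod 2) :=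
  Matrix.of fun i j => e (Sum.inr (Sum.inr (i, j)))

variable [Fintype X] [Fintype Q] [Fintype Z] [Fintype X'] [Fintype Q'] [Fintype Z']

theorem dotProduct_eq_trace_sectors (e w : Z × X' ⊕ (Q × Q' ⊕ X × Z') → ZMod 2) :
    e ⬝ᵥ w = trace ((leftSector e)ᵀ * leftSector w) + trace ((midSector e)ᵀ * midSector w) +
      trace ((rightSector e)ᵀ * rightSector w) := by
  rw [leftSector, leftSector, midSector, midSector, rightSector, rightSector]
  simp only [trace, diag_apply, mul_apply, transpose_apply, of_apply, dotProduct,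
    Fintype.sum_sum_type, Fintype.sum_prod_type_right, add_assoc]

theorem leftVec_dotProduct (a : Z → ZMod 2) (b : X' → ZMod 2)
    (w : Z × X' ⊕ (Q × Q' ⊕ X × Z') → ZMod 2) :
    leftVec a b ⬝ᵥ w = a ⬝ᵥ (leftSector w *ᵥ b) := by
  simp [leftVec, leftSector, dotProduct, mulVec, Fintype.sum_prod_type, Finset.mul_sum, mul_assoc,
    mul_comm]

theorem rightVec_dotProduct (a : X → ZMod 2) (b : Z' → ZMod 2)
    (w : Z × X' ⊕ (Q × Q' ⊕ X × Z') → ZMod 2) :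
    rightVec a b ⬝ᵥ w = a ⬝ᵥ (rightSector w *ᵥ b) := by
  simp [rightVec, rightSector, dotProduct, mulVec, Fintype.sum_prod_type, Finset.mul_sum,
    mul_assoc, mul_comm]

theorem kronecker_mulVec_uncurry {α β γ δ : Type*} [Fintype β] [Fintype δ]
    (A : Matrix α β (ZMod 2)) (B : Matrix γ δ (ZMod 2)) (e : β × δ → ZMod 2) :
    (A ⊗ₖ B) *ᵥ e = fun p => (A * Matrix.of (Function.curry e) * Bᵀ) p.1 p.2 := by
  have := kronecker_mulVec_vec B (Matrix.of (Function.curry e))ᵀ A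
  ext p
  refine (congrFun this p).trans ?_
  rw [← transpose_transpose B, ← transpose_mul, transpose_transpose, ← transpose_mul,
    ← Matrix.mul_assoc]
  rfl

/-- If `M` pairs to zero with all `z ⊗ z'` for `z ∈ ker B` and `z' ∈ ker B'`, it pairs to zero with
`ker B ⊗ ker B'`. -/
theorem trace_transpose_mul_eq_zero_of_ker {X X' : Type*} [DecidableEq Q] [DecidableEq Q']
    (B : Matrix X Q (ZMod 2)) (B' : Matrix X' Q' (ZMod 2)) {M m : Matrix Q Q' (ZMod 2)}
    (hM : ∀ z z', B *ᵥ z = 0 → B' *ᵥ z' = 0 → z ⬝ᵥ (M *ᵥ z') = 0)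
    (hB : B * m = 0) (hB' : m * B'ᵀ = 0) : trace (Mᵀ * m) = 0 := by
  obtain ⟨P, hP, hPz⟩ := exists_ker_projection B
  obtain ⟨P', hP', hPz'⟩ := exists_ker_projection B'
  have h1 : P * m = m := Matrix.ext_of_mulVec_single fun j => by
    rw [← mulVec_mulVec]
    exact hPz _ (by rw [mulVec_mulVec, hB, zero_mulVec])
  have h2 : P' * mᵀ = mᵀ := Matrix.ext_of_mulVec_single fun j => by
    rw [← mulVec_mulVec]
    refine hPz' _ ?_
    rw [mulVec_mulVec, ← transpose_transpose B', ← transpose_mul, hB', transpose_zero, zero_mulVec]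
  have h3 : m * P'ᵀ = m := by rw [← transpose_inj, transpose_mul, transpose_transpose, h2]
  -- The columns of `P` and `P'` lie in the two kernels.
  have h4 : Pᵀ * M * P' = 0 := by
    ext i j
    have := hM (P *ᵥ Pi.single i 1) (P' *ᵥ Pi.single j 1) (by rw [mulVec_mulVec, hP, zero_mulVec])
      (by rw [mulVec_mulVec, hP', zero_mulVec])
    rw [mulVec_single_one, mulVec_single_one] at this
    rw [Matrix.mul_assoc]
    exact this
  calc trace (Mᵀ * m) = trace (Mᵀ * (P * (m * P'ᵀ))) := by rw [h3, h1]
    _ = trace ((Pᵀ * M * P')ᵀ * m) := by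
      rw [← Matrix.mul_assoc, ← Matrix.mul_assoc, trace_mul_comm, transpose_mul, transpose_mul,
        transpose_transpose, Matrix.mul_assoc, Matrix.mul_assoc, Matrix.mul_assoc]
    _ = 0 := by rw [h4, transpose_zero, Matrix.zero_mul, trace_zero]

/-- The Künneth argument in terms of the three sectors: `(L, M, R)` is a cocycle of the product
complex, `(wL, wM, wR)` is a cycle which is orthogonal to the products of cocycles on the outer
sectors, and `M` is orthogonal to the products of cycles on the middle sector. The orthogonality
makes `wL` and `wR` the outer parts of a boundary, so that the cycle is homologous to an element
of `ker B ⊗ ker B'`. -/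
theorem sector_pairing_eq_zero [DecidableEq X] [DecidableEq Q] [DecidableEq X'] [DecidableEq Q']
    {A : Matrix Z Q (ZMod 2)} {B : Matrix X Q (ZMod 2)}
    {A' : Matrix Z' Q' (ZMod 2)} {B' : Matrix X' Q' (ZMod 2)}
    (hBA : B * Aᵀ = 0) (hBA' : B' * A'ᵀ = 0)
    {L wL : Matrix Z X' (ZMod 2)} {M wM : Matrix Q Q' (ZMod 2)} {R wR : Matrix X Z' (ZMod 2)}
    (hL : L * B' + A * M = 0) (hR : M * A'ᵀ + Bᵀ * R = 0)
    (hwL : Aᵀ * wL + wM * B'ᵀ = 0) (hwR : B * wM + wR * A' = 0)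
    (hgL : ∀ b, B'ᵀ *ᵥ b = 0 → wL *ᵥ b = 0) (hgR : ∀ a, Bᵀ *ᵥ a = 0 → wRᵀ *ᵥ a = 0)
    (hM : ∀ z z', B *ᵥ z = 0 → B' *ᵥ z' = 0 → z ⬝ᵥ (M *ᵥ z') = 0) :
    trace (Lᵀ * wL) + trace (Mᵀ * wM) + trace (Rᵀ * wR) = 0 := by
  -- The rows of `wL` are orthogonal to `ker B'ᵀ`, so they lie in the column space of `B'`;
  -- similarly for the columns of `wR`.
  have hu : ∀ i, ∃ u, B' *ᵥ u = wL i := fun i =>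
    exists_mulVec_eq_of_forall_dotProduct_eq_zero B' fun b hb => congrFun (hgL b hb) i
  have hv : ∀ j, ∃ v, B *ᵥ v = wRᵀ j := fun j =>
    exists_mulVec_eq_of_forall_dotProduct_eq_zero B fun a ha => congrFun (hgR a ha) j
  choose u hu using hu
  choose v hv using hv
  obtain rfl : Matrix.of u * B'ᵀ = wL := by
    ext i j
    rw [← hu i]
    simp [mul_apply, mulVec, dotProduct, mul_comm]
  obtain rfl : B * (Matrix.of v)ᵀ = wR := by
    ext i j
    rw [← transpose_apply wR, ← hv j]
    simp [mul_apply, mulVec, dotProduct]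
  generalize Matrix.of u = u at *
  generalize (Matrix.of v)ᵀ = v at *
  have hBA2 : A' * B'ᵀ = 0 := by rw [← transpose_inj, transpose_mul]; simpa using hBA'
  -- Subtracting the boundary of `(u, v)` from the cycle leaves `m` on the middle sector only.
  obtain ⟨m, rfl⟩ : ∃ m, wM = m - Aᵀ * u - v * A' := ⟨wM + v * A' + Aᵀ * u, by abel⟩
  have h1 : B * m = 0 := by
    rw [Matrix.mul_sub, Matrix.mul_sub, ← Matrix.mul_assoc B Aᵀ, hBA, Matrix.zero_mul, sub_zero,
      Matrix.mul_assoc, sub_add_cancel] at hwR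
    exact hwR
  have h2 : m * B'ᵀ = 0 := by
    rw [Matrix.sub_mul, Matrix.sub_mul, Matrix.mul_assoc v, hBA2, Matrix.mul_zero, sub_zero,
      Matrix.mul_assoc, add_sub_cancel] at hwL
    exact hwL
  have h3 : trace (Mᵀ * m) = 0 := trace_transpose_mul_eq_zero_of_ker B B' hM h1 h2
  -- The cocycle `(L, M, R)` pairs to zero with the boundary of `(u, v)`.
  have hL' : trace (Lᵀ * (u * B'ᵀ)) + trace (Mᵀ * (Aᵀ * u)) = 0 := by
    have := congrArg (fun N => trace (Nᵀ * u)) hL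
    simp only [transpose_add, transpose_mul, Matrix.add_mul, trace_add, transpose_zero,
      Matrix.zero_mul, trace_zero] at this
    rw [← Matrix.mul_assoc, trace_mul_comm, ← Matrix.mul_assoc, ← Matrix.mul_assoc]
    exact this
  have hR' : trace (Mᵀ * (v * A')) + trace (Rᵀ * (B * v)) = 0 := by
    have := congrArg (fun N => trace (Nᵀ * v)) hR
    simp only [transpose_add, transpose_mul, Matrix.add_mul, trace_add, transpose_zero,
      Matrix.zero_mul, trace_zero, transpose_transpose] at this
    rw [← Matrix.mul_assoc, trace_mul_comm, ← Matrix.mul_assoc, ← Matrix.mul_assoc]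
    exact this
  rw [Matrix.mul_sub, Matrix.mul_sub, trace_sub, trace_sub, h3]
  simp only [ZModModule.sub_eq_add]
  linear_combination hL' + hR'

variable [DecidableEq X] [DecidableEq Q] [DecidableEq Z]
  [DecidableEq X'] [DecidableEq Q'] [DecidableEq Z']

theorem homProduct_HZ_mulVec_eq_zero_iff (C : CSSCode X Q Z) (C' : CSSCode X' Q' Z')
    (e : Z × X' ⊕ (Q × Q' ⊕ X × Z') → ZMod 2) :
    (C.homProduct C').HZ *ᵥ e = 0 ↔
      leftSector e * C'.HX + C.HZ * midSector e = 0 ∧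
        midSector e * C'.HZᵀ + C.HXᵀ * rightSector e = 0 := by
  obtain ⟨l, e, rfl⟩ : ∃ l e', e = Sum.elim l e' := ⟨_, _, (Sum.elim_comp_inl_inr e).symm⟩
  obtain ⟨m, r, rfl⟩ : ∃ m r, e = Sum.elim m r := ⟨_, _, (Sum.elim_comp_inl_inr e).symm⟩
  simp only [CSSCode.homProduct, fromRows_mulVec, fromCols_mulVec_sumElim,
    kronecker_mulVec_uncurry, zero_mulVec, add_zero, zero_add, Matrix.one_mul, transpose_one,
    Matrix.mul_one, transpose_transpose]
  simp only [funext_iff, ← Matrix.ext_iff, Sum.forall, Prod.forall]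
  rfl

theorem homProduct_HX_mulVec_eq_zero_iff (C : CSSCode X Q Z) (C' : CSSCode X' Q' Z')
    (e : Z × X' ⊕ (Q × Q' ⊕ X × Z') → ZMod 2) :
    (C.homProduct C').HX *ᵥ e = 0 ↔
      C.HZᵀ * leftSector e + midSector e * C'.HXᵀ = 0 ∧
        C.HX * midSector e + rightSector e * C'.HZ = 0 := by
  obtain ⟨l, e, rfl⟩ : ∃ l e', e = Sum.elim l e' := ⟨_, _, (Sum.elim_comp_inl_inr e).symm⟩
  obtain ⟨m, r, rfl⟩ : ∃ m r, e = Sum.elim m r := ⟨_, _, (Sum.elim_comp_inl_inr e).symm⟩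
  simp only [CSSCode.homProduct, fromRows_mulVec, fromCols_mulVec_sumElim,
    kronecker_mulVec_uncurry, zero_mulVec, add_zero, zero_add, Matrix.one_mul, transpose_one,
    Matrix.mul_one, transpose_transpose]
  simp only [funext_iff, ← Matrix.ext_iff, Sum.forall, Prod.forall]
  rfl

theorem mulVec_eq_zero_of_forall_dotProduct {α β : Type*} [Fintype α] [DecidableEq α] [Fintype β]
    {N : Matrix α β (ZMod 2)} {b : β → ZMod 2} (h : ∀ a, a ⬝ᵥ (N *ᵥ b) = 0) : N *ᵥ b = 0 :=
  dotProduct_eq_zero _ fun a => by rw [dotProduct_comm, h]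

/-- Contracting the middle sector of a dressed logical `X` operator with a suitable `Z`-type logical
operator of either code leaves a logical `X` operator of the other one. -/
theorem CSSSubsystemCode.IsLogicalX.exists_contraction {C : CSSCode X Q Z}
    {C' : CSSCode X' Q' Z'} {e : Z × X' ⊕ (Q × Q' ⊕ X × Z') → ZMod 2}
    (he : (C.middleSector C').IsLogicalX e) :
    (∃ z', C.noGauge.IsLogicalX (midSector e *ᵥ z')) ∧
      ∃ z, C'.noGauge.IsLogicalX ((midSector e)ᵀ *ᵥ z) := by
  obtain ⟨hker, hmem⟩ := he
  obtain ⟨w, hw, hew⟩ := exists_dotProduct_ne_zero_of_notMem hmem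
  obtain ⟨hL, hR⟩ := (homProduct_HZ_mulVec_eq_zero_iff C C' e).1 hker
  obtain ⟨hwL, hwR⟩ := (homProduct_HX_mulVec_eq_zero_iff C C' w).1
    (mulVec_eq_zero_of_rowSpace fun s hs => hw s (Submodule.mem_sup_left hs))
  have hgL : ∀ b, C'.HXᵀ *ᵥ b = 0 → leftSector w *ᵥ b = 0 := fun b hb =>
    mulVec_eq_zero_of_forall_dotProduct fun a => by
      rw [← leftVec_dotProduct]
      exact hw _ (Submodule.mem_sup_right (Submodule.subset_span (Or.inl ⟨a, b, hb, rfl⟩)))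
  have hgR : ∀ a, C.HXᵀ *ᵥ a = 0 → (rightSector w)ᵀ *ᵥ a = 0 := fun a ha =>
    mulVec_eq_zero_of_forall_dotProduct fun b => by
      rw [mulVec_transpose, dotProduct_comm, ← dotProduct_mulVec, ← rightVec_dotProduct]
      exact hw _ (Submodule.mem_sup_right (Submodule.subset_span (Or.inr ⟨a, b, ha, rfl⟩)))
  have : ∃ z z', C.HX *ᵥ z = 0 ∧ C'.HX *ᵥ z' = 0 ∧ z ⬝ᵥ (midSector e *ᵥ z') ≠ 0 := by
    by_contra! h
    exact hew ((dotProduct_eq_trace_sectors e w).trans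
      (sector_pairing_eq_zero C.css C'.css hL hR hwL hwR hgL hgR h))
  obtain ⟨z, z', hz, hz', hne⟩ := this
  refine ⟨⟨z', ?_, fun h => hne ?_⟩, ⟨z, ?_, fun h => hne ?_⟩⟩
  · change C.HZ *ᵥ _ = 0
    have := congrArg (· *ᵥ z') hL
    simpa [add_mulVec, ← mulVec_mulVec, hz'] using this
  · rw [dotProduct_comm]
    exact mem_rowSpace_dotProduct_eq_zero (by simpa [CSSCode.noGauge] using h) hz
  · change C'.HZ *ᵥ _ = 0
    have := congrArg (fun N => Nᵀ *ᵥ z) hR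
    simpa [add_mulVec, ← mulVec_mulVec, hz] using this
  · rw [dotProduct_mulVec, ← mulVec_transpose]
    exact mem_rowSpace_dotProduct_eq_zero (by simpa [CSSCode.noGauge] using h) hz'

/-- The version of `CSSSubsystemCode.IsLogicalX.exists_contraction` for `Z` operators: transposing
the grid and exchanging the roles of `X` and `Z` turns one into the other. -/
theorem CSSSubsystemCode.IsLogicalZ.exists_contraction {C : CSSCode X Q Z}
    {C' : CSSCode X' Q' Z'} {e : Z × X' ⊕ (Q × Q' ⊕ X × Z') → ZMod 2}
    (he : (C.middleSector C').IsLogicalZ e) :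
    (∃ z', C.noGauge.IsLogicalZ (midSector e *ᵥ z')) ∧
      ∃ z, C'.noGauge.IsLogicalZ ((midSector e)ᵀ *ᵥ z) := by
  obtain ⟨hker, hmem⟩ := he
  obtain ⟨w, hw, hew⟩ := exists_dotProduct_ne_zero_of_notMem hmem
  obtain ⟨hL, hR⟩ := (homProduct_HX_mulVec_eq_zero_iff C C' e).1 hker
  obtain ⟨hwL, hwR⟩ := (homProduct_HZ_mulVec_eq_zero_iff C C' w).1
    (mulVec_eq_zero_of_rowSpace fun s hs => hw s (Submodule.mem_sup_left hs))
  have hgL : ∀ a, C.HZᵀ *ᵥ a = 0 → (leftSector w)ᵀ *ᵥ a = 0 := fun a ha =>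
    mulVec_eq_zero_of_forall_dotProduct fun b => by
      rw [mulVec_transpose, dotProduct_comm, ← dotProduct_mulVec, ← leftVec_dotProduct]
      exact hw _ (Submodule.mem_sup_right (Submodule.subset_span (Or.inl ⟨a, b, ha, rfl⟩)))
  have hgR : ∀ b, C'.HZᵀ *ᵥ b = 0 → rightSector w *ᵥ b = 0 := fun b hb =>
    mulVec_eq_zero_of_forall_dotProduct fun a => by
      rw [← rightVec_dotProduct]
      exact hw _ (Submodule.mem_sup_right (Submodule.subset_span (Or.inr ⟨a, b, hb, rfl⟩)))
  have hcss : C.HZ * C.HXᵀ = 0 := by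
    rw [← transpose_inj, transpose_mul, transpose_transpose, C.css, transpose_zero]
  have hcss' : C'.HZ * C'.HXᵀ = 0 := by
    rw [← transpose_inj, transpose_mul, transpose_transpose, C'.css, transpose_zero]
  have : ∃ z z', C.HZ *ᵥ z = 0 ∧ C'.HZ *ᵥ z' = 0 ∧ z ⬝ᵥ (midSector e *ᵥ z') ≠ 0 := by
    by_contra! h
    -- On the transposed grid, with the duals of `C'` and `C` as first and second factor, the
    -- roles of `A, B, A', B'` are played by `C'.HX, C'.HZ, C.HX, C.HZ`.
    have key := sector_pairing_eq_zero (L := (leftSector e)ᵀ) (M := (midSector e)ᵀ)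
      (R := (rightSector e)ᵀ) (wL := (leftSector w)ᵀ) (wM := (midSector w)ᵀ)
      (wR := (rightSector w)ᵀ) hcss' hcss
      (by simpa using congrArg transpose hL) (by simpa using congrArg transpose hR)
      (by simpa using congrArg transpose hwL) (by simpa using congrArg transpose hwR)
      hgL (by simpa using hgR) (fun z' z hz' hz => by
        rw [dotProduct_comm, mulVec_transpose, ← dotProduct_mulVec]
        exact h z z' hz hz')
    exact hew ((dotProduct_eq_trace_sectors e w).trans
      (by simpa only [trace_transpose_mul] using key))
  obtain ⟨z, z', hz, hz', hne⟩ := this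
  refine ⟨⟨z', ?_, fun h => hne ?_⟩, ⟨z, ?_, fun h => hne ?_⟩⟩
  · change C.HX *ᵥ _ = 0
    have := congrArg (· *ᵥ z') hR
    simpa [add_mulVec, ← mulVec_mulVec, hz'] using this
  · rw [dotProduct_comm]
    exact mem_rowSpace_dotProduct_eq_zero (by simpa [CSSCode.noGauge] using h) hz
  · change C'.HX *ᵥ _ = 0
    have := congrArg (fun N => Nᵀ *ᵥ z) hL
    simpa [add_mulVec, ← mulVec_mulVec, hz] using this
  · rw [dotProduct_mulVec, ← mulVec_transpose]
    exact mem_rowSpace_dotProduct_eq_zero (by simpa [CSSCode.noGauge] using h) hz'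

end Kunneth

/-! ### Parallel composition of time steps and circuits -/

section Parallel

variable {ι κ : Type*} [Fintype ι] [DecidableEq ι] [Fintype κ] [DecidableEq κ]

theorem TimeStep.ext_of {s t : TimeStep ι} (hp : s.perm = t.perm)
    (hg : s.gates.gate = t.gates.gate)
    (hm : (s.gates.mat : Matrix ι ι (ZMod 2)) = t.gates.mat) : s = t := by
  obtain ⟨p, ⟨g, m, h⟩⟩ := s
  obtain ⟨p', ⟨g', m', h'⟩⟩ := t
  obtain rfl : p = p' := hp
  obtain rfl : g = g' := hg
  obtain rfl : m = m' := Units.ext hm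
  rfl

theorem TimeStep.idle_par_idle :
    (TimeStep.idle (ι := ι)).par (TimeStep.idle (ι := κ)) = TimeStep.idle :=
  TimeStep.ext_of Equiv.Perm.sumCongr_one Sum.map_id_id Matrix.fromBlocks_one

theorem TimeStep.idle_onColumns : (TimeStep.idle (ι := ι)).onColumns κ = TimeStep.idle :=
  TimeStep.ext_of rfl rfl Matrix.one_kronecker_one

theorem TimeStep.idle_onRows : (TimeStep.idle (ι := ι)).onRows κ = TimeStep.idle :=
  TimeStep.ext_of rfl rfl Matrix.one_kronecker_one

theorem Circuit.stepAt_of_le (Γ : Circuit ι) {t : ℕ} (h : Γ.depth ≤ t) :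
    Γ.stepAt t = TimeStep.idle :=
  dif_neg h.not_gt

theorem Circuit.stepAt_par (Γ : Circuit ι) (Δ : Circuit κ) (t : ℕ) :
    (Γ.par Δ).stepAt t = (Γ.stepAt t).par (Δ.stepAt t) := by
  by_cases h : t < max Γ.depth Δ.depth
  · exact dif_pos h
  · have h' := not_lt.1 h
    rw [Circuit.stepAt_of_le _ h', Circuit.stepAt_of_le Γ (le_trans (le_max_left _ _) h'),
      Circuit.stepAt_of_le Δ (le_trans (le_max_right _ _) h'), TimeStep.idle_par_idle]

theorem Circuit.stepAt_onColumns (Γ : Circuit ι) (t : ℕ) :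
    (Γ.onColumns κ).stepAt t = (Γ.stepAt t).onColumns κ := by
  by_cases h : t < Γ.depth
  · have h' : t < (Γ.onColumns κ).depth := h
    rw [Circuit.stepAt, Circuit.stepAt, dif_pos h, dif_pos h']
    rfl
  · have h' := not_lt.1 h
    rw [Circuit.stepAt_of_le Γ h', TimeStep.idle_onColumns]
    exact Circuit.stepAt_of_le _ h'

theorem Circuit.stepAt_onRows (Γ : Circuit ι) (t : ℕ) :
    (Γ.onRows κ).stepAt t = (Γ.stepAt t).onRows κ := by
  by_cases h : t < Γ.depth
  · have h' : t < (Γ.onRows κ).depth := h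
    rw [Circuit.stepAt, Circuit.stepAt, dif_pos h, dif_pos h']
    rfl
  · have h' := not_lt.1 h
    rw [Circuit.stepAt_of_le Γ h', TimeStep.idle_onRows]
    exact Circuit.stepAt_of_le _ h'

theorem permMatrix_sumCongr {ι κ : Type*} [DecidableEq ι] [DecidableEq κ]
    (σ : Equiv.Perm ι) (τ : Equiv.Perm κ) :
    Equiv.Perm.permMatrix (ZMod 2) (Equiv.sumCongr σ τ) =
      fromBlocks (σ.permMatrix (ZMod 2)) 0 0 (τ.permMatrix (ZMod 2)) := by
  ext (i | i) (j | j) <;> simp [Equiv.Perm.permMatrix, PEquiv.toMatrix_apply]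

theorem permMatrix_prodCongr {ι κ : Type*} [DecidableEq ι] [DecidableEq κ]
    (σ : Equiv.Perm ι) (τ : Equiv.Perm κ) :
    Equiv.Perm.permMatrix (ZMod 2) (Equiv.prodCongr σ τ) =
      σ.permMatrix (ZMod 2) ⊗ₖ τ.permMatrix (ZMod 2) := by
  ext ⟨i, k⟩ ⟨j, l⟩
  simp [Equiv.Perm.permMatrix, PEquiv.toMatrix_apply, ← ite_and, and_comm]

theorem TimeStep.xMat_par (s : TimeStep ι) (t : TimeStep κ) :
    (s.par t).xMat = fromBlocks s.xMat 0 0 t.xMat := by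
  change Equiv.Perm.permMatrix (ZMod 2) (Equiv.sumCongr s.perm t.perm) * fromBlocks _ 0 0 _ = _
  rw [permMatrix_sumCongr, fromBlocks_multiply]
  simp [TimeStep.xMat]

theorem TimeStep.zMat_par (s : TimeStep ι) (t : TimeStep κ) :
    (s.par t).zMat = fromBlocks s.zMat 0 0 t.zMat := by
  change Equiv.Perm.permMatrix (ZMod 2) (Equiv.sumCongr s.perm t.perm) * (fromBlocks _ 0 0 _)ᵀ = _
  rw [permMatrix_sumCongr, fromBlocks_transpose, fromBlocks_multiply]
  simp [TimeStep.zMat]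

theorem TimeStep.xMat_onColumns (s : TimeStep ι) : (s.onColumns κ).xMat = s.xMat ⊗ₖ 1 := by
  change Equiv.Perm.permMatrix (ZMod 2) (Equiv.prodCongr s.perm (Equiv.refl κ)) * (_ ⊗ₖ 1) = _
  rw [permMatrix_prodCongr, ← mul_kronecker_mul, permMatrix_refl, Matrix.mul_one]
  rfl

theorem TimeStep.zMat_onColumns (s : TimeStep ι) : (s.onColumns κ).zMat = s.zMat ⊗ₖ 1 := by
  change Equiv.Perm.permMatrix (ZMod 2) (Equiv.prodCongr s.perm (Equiv.refl κ)) *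
    (_ ⊗ₖ ((1⁻¹ : Matrix.GeneralLinearGroup κ (ZMod 2)) : Matrix κ κ (ZMod 2)))ᵀ = _
  rw [permMatrix_prodCongr, ← kroneckerMap_transpose, ← mul_kronecker_mul, permMatrix_refl,
    inv_one, Units.val_one, transpose_one, Matrix.mul_one]
  rfl

theorem TimeStep.xMat_onRows (s : TimeStep ι) : (s.onRows κ).xMat = 1 ⊗ₖ s.xMat := by
  change Equiv.Perm.permMatrix (ZMod 2) (Equiv.prodCongr (Equiv.refl κ) s.perm) * (1 ⊗ₖ _) = _
  rw [permMatrix_prodCongr, ← mul_kronecker_mul, permMatrix_refl, Matrix.mul_one]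
  rfl

theorem TimeStep.zMat_onRows (s : TimeStep ι) : (s.onRows κ).zMat = 1 ⊗ₖ s.zMat := by
  change Equiv.Perm.permMatrix (ZMod 2) (Equiv.prodCongr (Equiv.refl κ) s.perm) *
    (((1⁻¹ : Matrix.GeneralLinearGroup κ (ZMod 2)) : Matrix κ κ (ZMod 2)) ⊗ₖ _)ᵀ = _
  rw [permMatrix_prodCongr, ← kroneckerMap_transpose, ← mul_kronecker_mul, permMatrix_refl,
    inv_one, Units.val_one, transpose_one, Matrix.mul_one]
  rfl

end Parallel

/-! ### Projections of circuits -/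

section Projections

variable {ι κ μ : Type*} [Fintype ι] [DecidableEq ι] [Fintype κ] [DecidableEq κ]
  [Fintype μ] [DecidableEq μ]

/-- The linear map `φ` of Pauli supports carries the action of the time step `s` to that of `t`, and
no error needs more elementary faults in `t` after the projection than in `s` before it. -/
structure TimeStep.ProjectsTo (φ : (ι → ZMod 2) →ₗ[ZMod 2] (κ → ZMod 2)) (s : TimeStep ι)
    (t : TimeStep κ) : Prop where
  xMat : ∀ v, φ (v ᵥ* s.xMat) = φ v ᵥ* t.xMat
  zMat : ∀ v, φ (v ᵥ* s.zMat) = φ v ᵥ* t.zMat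
  faultCount_le : ∀ e : Pauli ι, t.gates.faultCount (φ e.1, φ e.2) ≤ s.gates.faultCount e

/-- The linear map `φ` of Pauli supports carries the circuit `Γ` to the circuit `Δ`, which may be
shorter, and does not increase the number of faults. -/
structure Circuit.ProjectsTo (φ : (ι → ZMod 2) →ₗ[ZMod 2] (κ → ZMod 2)) (Γ : Circuit ι)
    (Δ : Circuit κ) : Prop where
  depth_le : Δ.depth ≤ Γ.depth
  step : ∀ t, (Γ.stepAt t).ProjectsTo φ (Δ.stepAt t)
  finalPerm : ∀ v, φ (v ᵥ* Γ.finalPerm.permMatrix (ZMod 2)) =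
    φ v ᵥ* Δ.finalPerm.permMatrix (ZMod 2)

theorem TimeStep.ProjectsTo.comp {φ : (ι → ZMod 2) →ₗ[ZMod 2] (κ → ZMod 2)}
    {ψ : (κ → ZMod 2) →ₗ[ZMod 2] (μ → ZMod 2)} {s : TimeStep ι} {t : TimeStep κ} {u : TimeStep μ}
    (hψ : t.ProjectsTo ψ u) (hφ : s.ProjectsTo φ t) : s.ProjectsTo (ψ ∘ₗ φ) u where
  xMat v := by simp [hφ.xMat, hψ.xMat]
  zMat v := by simp [hφ.zMat, hψ.zMat]
  faultCount_le e := (hψ.faultCount_le (φ e.1, φ e.2)).trans (hφ.faultCount_le e)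

theorem Circuit.ProjectsTo.comp {φ : (ι → ZMod 2) →ₗ[ZMod 2] (κ → ZMod 2)}
    {ψ : (κ → ZMod 2) →ₗ[ZMod 2] (μ → ZMod 2)} {Γ : Circuit ι} {Δ : Circuit κ} {Θ : Circuit μ}
    (hψ : Δ.ProjectsTo ψ Θ) (hφ : Γ.ProjectsTo φ Δ) : Γ.ProjectsTo (ψ ∘ₗ φ) Θ where
  depth_le := hψ.depth_le.trans hφ.depth_le
  step t := (hψ.step t).comp (hφ.step t)
  finalPerm v := by simp [hφ.finalPerm, hψ.finalPerm]

/-- If every faulty qubit of `e'` is accompanied by a faulty qubit of `e` whose gate determines the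
gate of the former (through `r`), then `e'` has no more faulty gates than `e`. -/
theorem GateLayer.faultCount_le_of_rel {g : GateLayer ι} {h : GateLayer κ} {e : Pauli ι}
    {e' : Pauli κ} (r : κ → ι → Prop)
    (hs : ∀ i, e'.1 i ≠ 0 ∨ e'.2 i ≠ 0 →
      ∃ j, (e.1 j ≠ 0 ∨ e.2 j ≠ 0) ∧ r (h.gate i) (g.gate j))
    (hr : ∀ a a' b, r a b → r a' b → a = a') : h.faultCount e' ≤ g.faultCount e := by
  refine Finset.card_le_card_of_forall_subsingleton r (fun a ha => ?_)
    fun b _ a ha a' ha' => hr a a' b ha.2 ha'.2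
  obtain ⟨i, hi, rfl⟩ := Finset.mem_image.1 ha
  obtain ⟨j, hj, hij⟩ := hs i (Finset.mem_filter.1 hi).2
  exact ⟨_, Finset.mem_image_of_mem _ (Finset.mem_filter.2 ⟨Finset.mem_univ _, hj⟩), hij⟩

theorem funLeft_inl_vecMul {ι κ : Type*} [Fintype ι] [Fintype κ] (v : ι ⊕ κ → ZMod 2)
    (A : Matrix ι ι (ZMod 2)) (B : Matrix κ κ (ZMod 2)) :
    LinearMap.funLeft (ZMod 2) (ZMod 2) Sum.inl (v ᵥ* fromBlocks A 0 0 B) =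
      LinearMap.funLeft (ZMod 2) (ZMod 2) Sum.inl v ᵥ* A := by
  ext i
  simp [vecMul_fromBlocks, LinearMap.funLeft]

theorem funLeft_inr_vecMul {ι κ : Type*} [Fintype ι] [Fintype κ] (v : ι ⊕ κ → ZMod 2)
    (A : Matrix ι ι (ZMod 2)) (B : Matrix κ κ (ZMod 2)) :
    LinearMap.funLeft (ZMod 2) (ZMod 2) Sum.inr (v ᵥ* fromBlocks A 0 0 B) =
      LinearMap.funLeft (ZMod 2) (ZMod 2) Sum.inr v ᵥ* B := by
  ext i
  simp [vecMul_fromBlocks, LinearMap.funLeft]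

theorem Circuit.projectsTo_par_left (Γ : Circuit ι) (Δ : Circuit κ) :
    (Γ.par Δ).ProjectsTo (LinearMap.funLeft (ZMod 2) (ZMod 2) Sum.inl) Γ where
  depth_le := le_max_left _ _
  step t := by
    rw [Circuit.stepAt_par]
    exact
      { xMat := fun v => by rw [TimeStep.xMat_par, funLeft_inl_vecMul]
        zMat := fun v => by rw [TimeStep.zMat_par, funLeft_inl_vecMul]
        faultCount_le := fun e => GateLayer.faultCount_le_of_rel (fun a b => Sum.inl a = b)
          (fun i hi => ⟨Sum.inl i, hi, rfl⟩) fun a a' b h h' => Sum.inl.inj (h.trans h'.symm) }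
  finalPerm v := by
    change LinearMap.funLeft (ZMod 2) (ZMod 2) Sum.inl
      (v ᵥ* Equiv.Perm.permMatrix (ZMod 2) (Equiv.sumCongr _ _)) = _
    rw [permMatrix_sumCongr, funLeft_inl_vecMul]

theorem Circuit.projectsTo_par_right (Γ : Circuit ι) (Δ : Circuit κ) :
    (Γ.par Δ).ProjectsTo (LinearMap.funLeft (ZMod 2) (ZMod 2) Sum.inr) Δ where
  depth_le := le_max_right _ _
  step t := by
    rw [Circuit.stepAt_par]
    exact
      { xMat := fun v => by rw [TimeStep.xMat_par, funLeft_inr_vecMul]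
        zMat := fun v => by rw [TimeStep.zMat_par, funLeft_inr_vecMul]
        faultCount_le := fun e => GateLayer.faultCount_le_of_rel (fun a b => Sum.inr a = b)
          (fun i hi => ⟨Sum.inr i, hi, rfl⟩) fun a a' b h h' => Sum.inr.inj (h.trans h'.symm) }
  finalPerm v := by
    change LinearMap.funLeft (ZMod 2) (ZMod 2) Sum.inr
      (v ᵥ* Equiv.Perm.permMatrix (ZMod 2) (Equiv.sumCongr _ _)) = _
    rw [permMatrix_sumCongr, funLeft_inr_vecMul]

theorem funLeft_swap_vecMul {ι : Type*} [Fintype ι] (v : κ × ι → ZMod 2) (A : Matrix ι ι (ZMod 2)) :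
    LinearMap.funLeft (ZMod 2) (ZMod 2) Prod.swap
        (v ᵥ* ((1 : Matrix κ κ (ZMod 2)) ⊗ₖ A)) =
      LinearMap.funLeft (ZMod 2) (ZMod 2) Prod.swap v ᵥ* (A ⊗ₖ (1 : Matrix κ κ (ZMod 2))) := by
  ext ⟨i, k⟩
  simp [vecMul, dotProduct, LinearMap.funLeft, Fintype.sum_prod_type, Matrix.one_apply]

/-- Transposing the grid turns a circuit that runs on the rows into one that runs on the columns. -/
theorem Circuit.projectsTo_onColumns_of_onRows (Γ : Circuit ι) :
    (Γ.onRows κ).ProjectsTo (LinearMap.funLeft (ZMod 2) (ZMod 2) Prod.swap) (Γ.onColumns κ) where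
  depth_le := le_rfl
  step t := by
    rw [Circuit.stepAt_onRows, Circuit.stepAt_onColumns]
    exact
      { xMat := fun v => by rw [TimeStep.xMat_onRows, TimeStep.xMat_onColumns, funLeft_swap_vecMul]
        zMat := fun v => by rw [TimeStep.zMat_onRows, TimeStep.zMat_onColumns, funLeft_swap_vecMul]
        faultCount_le := fun e => GateLayer.faultCount_le_of_rel (fun a b => Prod.swap a = b)
          (fun i hi => ⟨i.swap, hi, rfl⟩)
          fun a a' b h h' => Prod.swap_injective (h.trans h'.symm) }
  finalPerm v := by
    change LinearMap.funLeft (ZMod 2) (ZMod 2) Prod.swap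
      (v ᵥ* Equiv.Perm.permMatrix (ZMod 2) (Equiv.prodCongr (Equiv.refl κ) Γ.finalPerm)) =
      _ ᵥ* Equiv.Perm.permMatrix (ZMod 2) (Equiv.prodCongr Γ.finalPerm (Equiv.refl κ))
    rw [permMatrix_prodCongr, permMatrix_prodCongr, permMatrix_refl, funLeft_swap_vecMul]

/-- Contraction of a vector on an `ι × κ` grid with a vector on the set `κ` of columns. -/
def contractColumns (ι : Type*) (c : κ → ZMod 2) : (ι × κ → ZMod 2) →ₗ[ZMod 2] (ι → ZMod 2) where
  toFun v i := ∑ k, v (i, k) * c k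
  map_add' v w := by ext i; simp [add_mul, Finset.sum_add_distrib]
  map_smul' a v := by ext i; simp [Finset.mul_sum, mul_assoc]

theorem vecMul_kronecker_one_apply {ι : Type*} [Fintype ι] (v : ι × κ → ZMod 2)
    (A : Matrix ι ι (ZMod 2)) (i : ι) (k : κ) :
    (v ᵥ* (A ⊗ₖ (1 : Matrix κ κ (ZMod 2)))) (i, k) = ∑ j, v (j, k) * A j i := by
  simp [vecMul, dotProduct, Fintype.sum_prod_type, Matrix.one_apply]

theorem contractColumns_vecMul {ι : Type*} [Fintype ι] (c : κ → ZMod 2) (v : ι × κ → ZMod 2)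
    (A : Matrix ι ι (ZMod 2)) :
    contractColumns ι c (v ᵥ* (A ⊗ₖ (1 : Matrix κ κ (ZMod 2)))) = contractColumns ι c v ᵥ* A := by
  ext i
  simp only [contractColumns, LinearMap.coe_mk, AddHom.coe_mk, vecMul_kronecker_one_apply]
  simp only [vecMul, dotProduct, Finset.sum_mul]
  rw [Finset.sum_comm]
  exact Finset.sum_congr rfl fun j _ => Finset.sum_congr rfl fun k _ =>
    mul_right_comm (v (j, k)) (A j i) (c k)

theorem exists_ne_zero_of_contractColumns_ne_zero {ι κ : Type*} [Fintype κ] {c : κ → ZMod 2}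
    {v : ι × κ → ZMod 2} {i : ι} (h : contractColumns ι c v i ≠ 0) : ∃ k, v (i, k) ≠ 0 := by
  obtain ⟨k, -, hk⟩ := Finset.exists_ne_zero_of_sum_ne_zero h
  exact ⟨k, left_ne_zero_of_mul hk⟩

/-- A gate of the circuit is applied to all columns; the contraction is faulty at this gate only if
one of its copies is. -/
theorem Circuit.projectsTo_of_onColumns (Γ : Circuit ι) (c : κ → ZMod 2) :
    (Γ.onColumns κ).ProjectsTo (contractColumns ι c) Γ where
  depth_le := le_rfl
  step t := by
    rw [Circuit.stepAt_onColumns]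
    refine
      { xMat := fun v => by rw [TimeStep.xMat_onColumns, contractColumns_vecMul]
        zMat := fun v => by rw [TimeStep.zMat_onColumns, contractColumns_vecMul]
        faultCount_le := fun e => GateLayer.faultCount_le_of_rel (fun a b => a = b.1)
          (fun i hi => ?_) fun a a' b h h' => h.trans h'.symm }
    rcases hi with hi | hi
    · obtain ⟨k, hk⟩ := exists_ne_zero_of_contractColumns_ne_zero hi
      exact ⟨(i, k), Or.inl hk, rfl⟩
    · obtain ⟨k, hk⟩ := exists_ne_zero_of_contractColumns_ne_zero hi
      exact ⟨(i, k), Or.inr hk, rfl⟩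
  finalPerm v := by
    change contractColumns ι c
      (v ᵥ* Equiv.Perm.permMatrix (ZMod 2) (Equiv.prodCongr Γ.finalPerm (Equiv.refl κ))) = _
    rw [permMatrix_prodCongr, permMatrix_refl, contractColumns_vecMul]

end Projections

/-! ### Projections of faults -/

section Faults

variable {ι κ : Type*} [Fintype ι] [DecidableEq ι] [Fintype κ] [DecidableEq κ]

theorem GateLayer.faultCount_add_le (g : GateLayer ι) (e e' : Pauli ι) :
    g.faultCount (e + e') ≤ g.faultCount e + g.faultCount e' := by
  refine le_trans (Finset.card_le_card ?_) (Finset.card_union_le _ _)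
  rw [← Finset.image_union]
  refine Finset.image_subset_image fun i hi => ?_
  simp only [Finset.mem_union, Finset.mem_filter, Finset.mem_univ, true_and, Prod.fst_add,
    Prod.snd_add, Pi.add_apply] at hi ⊢
  by_contra! h
  simp [h.1.1, h.1.2, h.2.1, h.2.2] at hi

theorem GateLayer.faultCount_le_idle (g : GateLayer ι) (e : Pauli ι) :
    g.faultCount e ≤ (TimeStep.idle (ι := ι)).gates.faultCount e := by
  refine Finset.card_image_le.trans ?_
  rw [GateLayer.faultCount]
  exact (Finset.card_image_of_injective _ Function.injective_id).ge

theorem Circuit.errorAt_congr (Γ : Circuit ι) {f g : ℕ → Pauli ι} {t : ℕ}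
    (h : ∀ s ≤ t, f s = g s) : Γ.errorAt f t = Γ.errorAt g t := by
  induction t with
  | zero => exact h 0 le_rfl
  | succ t ih =>
    rw [Circuit.errorAt, Circuit.errorAt, ih fun s hs => h s (hs.trans t.le_succ), h _ le_rfl]

theorem Circuit.errorAt_succ_of_le (Γ : Circuit ι) (f : ℕ → Pauli ι) {t : ℕ} (h : Γ.depth ≤ t) :
    Γ.errorAt f (t + 1) = Γ.errorAt f t + f (t + 1) := by
  have hx : (TimeStep.idle (ι := ι)).xMat = 1 := by simp [TimeStep.xMat, TimeStep.idle]
  have hz : (TimeStep.idle (ι := ι)).zMat = 1 := by simp [TimeStep.zMat, TimeStep.idle]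
  rw [Circuit.errorAt, Circuit.stepAt_of_le Γ h, hx, hz, vecMul_one, vecMul_one]
  rfl

/-- An error on idle qubits after the last layer of gates can be attributed to that layer (or to the
incoming qubits if there is none), at no more than one elementary fault for each qubit. -/
theorem Circuit.exists_errorAt_depth_add (Γ : Circuit ι) (f : ℕ → Pauli ι) (e : Pauli ι) :
    ∃ g, Γ.errorAt g Γ.depth = Γ.errorAt f Γ.depth + e ∧
      Γ.faultCount g ≤ Γ.faultCount f + (TimeStep.idle (ι := ι)).gates.faultCount e := by
  -- Index `Γ.depth` of `f` is the last layer, or the incoming qubits if the depth is zero.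
  refine ⟨Function.update f Γ.depth (f Γ.depth + e), ?_⟩
  have hlt : ∀ s, s ≠ Γ.depth → Function.update f Γ.depth (f Γ.depth + e) s = f s :=
    fun s hs => Function.update_of_ne hs _ _
  have heq : Function.update f Γ.depth (f Γ.depth + e) Γ.depth = f Γ.depth + e :=
    Function.update_self _ _ _
  generalize Function.update f Γ.depth (f Γ.depth + e) = g at hlt heq
  unfold Circuit.faultCount
  generalize Γ.depth = D at hlt heq ⊢
  rcases D with _ | n
  · simp only [Finset.range_zero, Finset.sum_empty, add_zero, Circuit.errorAt, heq]
    exact ⟨trivial, GateLayer.faultCount_add_le _ _ _⟩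
  · constructor
    · rw [Circuit.errorAt, Circuit.errorAt,
        Γ.errorAt_congr fun s (hs : s ≤ n) => hlt s (by omega), heq]
      ext i <;> simp [add_assoc]
    · rw [Finset.sum_range_succ, Finset.sum_range_succ, hlt 0 (by omega), heq,
        Finset.sum_congr rfl fun s hs => by
          rw [hlt (s + 1) (by have := Finset.mem_range.1 hs; omega)]]
      have h1 := (Γ.stepAt n).gates.faultCount_add_le (f (n + 1)) e
      have h2 := (Γ.stepAt n).gates.faultCount_le_idle e
      omega

/-- Faults during additional idle steps after the end of a circuit do not help to cause an error at
its output. -/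
theorem Circuit.exists_errorAt_depth_eq (Γ : Circuit ι) (f : ℕ → Pauli ι) {D : ℕ}
    (hD : Γ.depth ≤ D) : ∃ g, Γ.errorAt g Γ.depth = Γ.errorAt f D ∧
      Γ.faultCount g ≤ (TimeStep.idle (ι := ι)).gates.faultCount (f 0) +
        ∑ t ∈ Finset.range D, (Γ.stepAt t).gates.faultCount (f (t + 1)) := by
  induction D, hD using Nat.le_induction with
  | base => exact ⟨f, rfl, le_rfl⟩
  | succ D hD ih =>
    obtain ⟨g, hg, hgc⟩ := ih
    obtain ⟨g', hg', hgc'⟩ := Γ.exists_errorAt_depth_add g (f (D + 1))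
    refine ⟨g', by rw [hg', hg, Γ.errorAt_succ_of_le f hD], hgc'.trans ?_⟩
    rw [Finset.sum_range_succ, Γ.stepAt_of_le hD]
    omega

theorem Circuit.ProjectsTo.errorAt {φ : (ι → ZMod 2) →ₗ[ZMod 2] (κ → ZMod 2)} {Γ : Circuit ι}
    {Δ : Circuit κ} (h : Γ.ProjectsTo φ Δ) (f : ℕ → Pauli ι) (t : ℕ) :
    Δ.errorAt (fun s => (φ (f s).1, φ (f s).2)) t =
      (φ (Γ.errorAt f t).1, φ (Γ.errorAt f t).2) := by
  induction t with
  | zero => rfl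
  | succ t ih =>
    rw [Circuit.errorAt, ih]
    simp only [Circuit.errorAt, map_add, (h.step t).xMat, (h.step t).zMat]

/-- The projection of an output error is caused by no more faults than the error itself. -/
theorem Circuit.ProjectsTo.exists_outputError_eq {φ : (ι → ZMod 2) →ₗ[ZMod 2] (κ → ZMod 2)}
    {Γ : Circuit ι} {Δ : Circuit κ} (h : Γ.ProjectsTo φ Δ) (f : ℕ → Pauli ι) :
    ∃ g, Δ.outputError g = (φ (Γ.outputError f).1, φ (Γ.outputError f).2) ∧
      Δ.faultCount g ≤ Γ.faultCount f := by
  obtain ⟨g, hg, hgc⟩ :=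
    Δ.exists_errorAt_depth_eq (fun s => (φ (f s).1, φ (f s).2)) h.depth_le
  refine ⟨g, ?_, hgc.trans (add_le_add ?_ (Finset.sum_le_sum fun t _ => ?_))⟩
  · rw [Circuit.outputError, hg, h.errorAt]
    simp only [Circuit.outputError, h.finalPerm]
  -- Both circuits are idle at time `Γ.depth`, and incoming faults are counted as for idle qubits.
  · have := (h.step Γ.depth).faultCount_le (f 0)
    rwa [Γ.stepAt_of_le le_rfl, Δ.stepAt_of_le h.depth_le] at this
  · exact (h.step t).faultCount_le _

/-! ### Faulty columns -/

open Classical in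
/-- The columns on which a Pauli operator on a grid acts nontrivially. -/
def faultyColumns (e : Pauli (ι × κ)) : Finset κ :=
  Finset.univ.filter fun k => ∃ i, e.1 (i, k) ≠ 0 ∨ e.2 (i, k) ≠ 0

theorem mem_faultyColumns {ι κ : Type*} [Fintype ι] [Fintype κ] {e : Pauli (ι × κ)} {k : κ} :
    k ∈ faultyColumns e ↔ ∃ i, e.1 (i, k) ≠ 0 ∨ e.2 (i, k) ≠ 0 := by
  simp [faultyColumns]

theorem faultyColumns_add_subset {ι : Type*} [Fintype ι] (e e' : Pauli (ι × κ)) :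
    faultyColumns (e + e') ⊆ faultyColumns e ∪ faultyColumns e' := by
  intro k hk
  obtain ⟨i, hi⟩ := mem_faultyColumns.1 hk
  rw [Finset.mem_union, mem_faultyColumns, mem_faultyColumns]
  by_contra! h
  simp [h.1 i, h.2 i] at hi

theorem faultyColumns_vecMul_subset {ι : Type*} [Fintype ι] (e : Pauli (ι × κ))
    (A B : Matrix ι ι (ZMod 2)) :
    faultyColumns (e.1 ᵥ* (A ⊗ₖ (1 : Matrix κ κ (ZMod 2))),
      e.2 ᵥ* (B ⊗ₖ (1 : Matrix κ κ (ZMod 2)))) ⊆ faultyColumns e := by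
  intro k hk
  obtain ⟨i, hi⟩ := mem_faultyColumns.1 hk
  simp only [vecMul_kronecker_one_apply] at hi
  rw [mem_faultyColumns]
  rcases hi with hi | hi
  · obtain ⟨j, -, hj⟩ := Finset.exists_ne_zero_of_sum_ne_zero hi
    exact ⟨j, Or.inl (left_ne_zero_of_mul hj)⟩
  · obtain ⟨j, -, hj⟩ := Finset.exists_ne_zero_of_sum_ne_zero hi
    exact ⟨j, Or.inr (left_ne_zero_of_mul hj)⟩

/-- A gate acts within a single column. -/
theorem card_faultyColumns_le (s : TimeStep ι) (e : Pauli (ι × κ)) :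
    (faultyColumns e).card ≤ (s.onColumns κ).gates.faultCount e := by
  refine Finset.card_le_card_of_forall_subsingleton (fun k (p : ι × κ) => k = p.2) (fun k hk => ?_)
    fun b _ a ha a' ha' => ha.2.trans ha'.2.symm
  obtain ⟨i, hi⟩ := mem_faultyColumns.1 hk
  exact ⟨_, Finset.mem_image_of_mem _ (Finset.mem_filter.2 ⟨Finset.mem_univ (i, k), hi⟩), rfl⟩

theorem Circuit.card_faultyColumns_errorAt_le (Γ : Circuit ι) (f : ℕ → Pauli (ι × κ)) (t : ℕ) :
    (faultyColumns ((Γ.onColumns κ).errorAt f t)).card ≤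
      (TimeStep.idle (ι := ι × κ)).gates.faultCount (f 0) +
        ∑ s ∈ Finset.range t, ((Γ.onColumns κ).stepAt s).gates.faultCount (f (s + 1)) := by
  induction t with
  | zero =>
    rw [← TimeStep.idle_onColumns]
    exact (card_faultyColumns_le _ _).trans (Nat.le_add_right _ _)
  | succ t ih =>
    rw [Finset.sum_range_succ, ← add_assoc]
    refine (Finset.card_le_card (faultyColumns_add_subset (_, _) (f (t + 1)))).trans
      ((Finset.card_union_le _ _).trans (add_le_add ?_ ?_))
    · refine le_trans (Finset.card_le_card ?_) ih
      rw [Circuit.stepAt_onColumns, TimeStep.xMat_onColumns, TimeStep.zMat_onColumns]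
      exact faultyColumns_vecMul_subset _ _ _
    · rw [Circuit.stepAt_onColumns]
      exact card_faultyColumns_le _ _

/-- Errors do not spread from one column to another. -/
theorem Circuit.card_faultyColumns_outputError_le (Γ : Circuit ι) (f : ℕ → Pauli (ι × κ)) :
    (faultyColumns ((Γ.onColumns κ).outputError f)).card ≤ (Γ.onColumns κ).faultCount f := by
  refine le_trans (Finset.card_le_card ?_) (Γ.card_faultyColumns_errorAt_le f _)
  have : (Γ.onColumns κ).finalPerm.permMatrix (ZMod 2) =
      Γ.finalPerm.permMatrix (ZMod 2) ⊗ₖ (1 : Matrix κ κ (ZMod 2)) :=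
    (permMatrix_prodCongr _ _).trans (by rw [permMatrix_refl])
  rw [Circuit.outputError, this]
  exact faultyColumns_vecMul_subset _ _ _

end Faults

/-! ### Fault distances of the inherited gadgets -/

section Distances

variable {ι κ : Type*} [Fintype ι] [DecidableEq ι] [Fintype κ] [DecidableEq κ]

theorem hammingNorm_mulVec_transpose_fst_le {ι κ : Type*} [Fintype ι] [Fintype κ]
    (e : Pauli (ι × κ)) (a : ι → ZMod 2) :
    hammingNorm ((Matrix.of (Function.curry e.1))ᵀ *ᵥ a) ≤ (faultyColumns e).card := by
  refine Finset.card_le_card fun k hk => mem_faultyColumns.2 ?_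
  obtain ⟨i, -, hi⟩ := Finset.exists_ne_zero_of_sum_ne_zero (Finset.mem_filter.1 hk).2
  exact ⟨i, Or.inl (left_ne_zero_of_mul hi)⟩

theorem hammingNorm_mulVec_transpose_snd_le {ι κ : Type*} [Fintype ι] [Fintype κ]
    (e : Pauli (ι × κ)) (a : ι → ZMod 2) :
    hammingNorm ((Matrix.of (Function.curry e.2))ᵀ *ᵥ a) ≤ (faultyColumns e).card := by
  refine Finset.card_le_card fun k hk => mem_faultyColumns.2 ?_
  obtain ⟨i, -, hi⟩ := Finset.exists_ne_zero_of_sum_ne_zero (Finset.mem_filter.1 hk).2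
  exact ⟨i, Or.inr (left_ne_zero_of_mul hi)⟩

/-- If the output error of a circuit which runs a distance-preserving gadget on all columns has
contractions that are logical `X` operators of the two codes, there are at least as many faults as
either `X` distance: the contraction over the columns is an output error of a single copy of the
gadget, and the weight of the contraction over the rows is at most the number of faulty columns. -/
theorem max_distX_le_faultCount {X Z X' Z' : Type*} [Fintype X] [Fintype Z] [DecidableEq X]
    [DecidableEq Z] {C : CSSCode X ι Z} {C' : CSSCode X' κ Z'} {G : Gadget C}
    (hG : G.DistancePreserving) {f : ℕ → Pauli (ι × κ)} {b : κ → ZMod 2} {a : ι → ZMod 2}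
    (hb : C.noGauge.IsLogicalX
      (Matrix.of (Function.curry ((G.circuitU.onColumns κ).outputError f).1) *ᵥ b))
    (ha : C'.noGauge.IsLogicalX
      ((Matrix.of (Function.curry ((G.circuitU.onColumns κ).outputError f).1))ᵀ *ᵥ a)) :
    max C.distX C'.distX ≤ ((G.circuitU.onColumns κ).faultCount f : ℕ∞) := by
  refine max_le ?_ ?_
  · obtain ⟨g, hg, hgc⟩ := (G.circuitU.projectsTo_of_onColumns b).exists_outputError_eq f
    exact hG.1.trans ((iInf₂_le g (by rw [hg]; exact hb)).trans (Nat.cast_le.2 hgc))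
  · exact (iInf₂_le _ ha).trans (Nat.cast_le.2 ((hammingNorm_mulVec_transpose_fst_le _ a).trans
      (G.circuitU.card_faultyColumns_outputError_le f)))

/-- The analogue of `max_distX_le_faultCount` for `Z` operators. -/
theorem max_distZ_le_faultCount {X Z X' Z' : Type*} [Fintype X] [Fintype Z] [DecidableEq X]
    [DecidableEq Z] {C : CSSCode X ι Z} {C' : CSSCode X' κ Z'} {G : Gadget C}
    (hG : G.DistancePreserving) {f : ℕ → Pauli (ι × κ)} {b : κ → ZMod 2} {a : ι → ZMod 2}
    (hb : C.noGauge.IsLogicalZ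
      (Matrix.of (Function.curry ((G.circuitU.onColumns κ).outputError f).2) *ᵥ b))
    (ha : C'.noGauge.IsLogicalZ
      ((Matrix.of (Function.curry ((G.circuitU.onColumns κ).outputError f).2))ᵀ *ᵥ a)) :
    max C.distZ C'.distZ ≤ ((G.circuitU.onColumns κ).faultCount f : ℕ∞) := by
  refine max_le ?_ ?_
  · obtain ⟨g, hg, hgc⟩ := (G.circuitU.projectsTo_of_onColumns b).exists_outputError_eq f
    exact hG.2.trans ((iInf₂_le g (by rw [hg]; exact hb)).trans (Nat.cast_le.2 hgc))
  · exact (iInf₂_le _ ha).trans (Nat.cast_le.2 ((hammingNorm_mulVec_transpose_snd_le _ a).trans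
      (G.circuitU.card_faultyColumns_outputError_le f)))

variable {X Q Z X' Q' Z' : Type*}
  [Fintype X] [Fintype Q] [Fintype Z] [Fintype X'] [Fintype Q'] [Fintype Z']
  [DecidableEq X] [DecidableEq Q] [DecidableEq Z]
  [DecidableEq X'] [DecidableEq Q'] [DecidableEq Z']

theorem Gadget.inheritFirst_projectsTo {C : CSSCode X Q Z} (G : Gadget C) :
    (G.inheritFirst X' Q' Z').ProjectsTo
      (LinearMap.funLeft (ZMod 2) (ZMod 2) Sum.inl ∘ₗ LinearMap.funLeft (ZMod 2) (ZMod 2) Sum.inr)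
      (G.circuitU.onColumns Q') :=
  (Circuit.projectsTo_par_left _ _).comp (Circuit.projectsTo_par_right _ _)

theorem Gadget.inheritSecond_projectsTo {C' : CSSCode X' Q' Z'} (G : Gadget C') :
    (G.inheritSecond X Q Z).ProjectsTo
      (LinearMap.funLeft (ZMod 2) (ZMod 2) Prod.swap ∘ₗ
        LinearMap.funLeft (ZMod 2) (ZMod 2) Sum.inl ∘ₗ
          LinearMap.funLeft (ZMod 2) (ZMod 2) Sum.inr)
      (G.circuitU.onColumns Q) :=
  (Circuit.projectsTo_onColumns_of_onRows _).comp
    ((Circuit.projectsTo_par_left _ _).comp (Circuit.projectsTo_par_right _ _))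

end Distances

end HomologicalProduct

theorem mainTheorem11 {X Q Z X' Q' Z' : Type*}
    [Fintype X] [Fintype Q] [Fintype Z] [Fintype X'] [Fintype Q'] [Fintype Z']
    [DecidableEq X] [DecidableEq Q] [DecidableEq Z]
    [DecidableEq X'] [DecidableEq Q'] [DecidableEq Z']
    (C : CSSCode X Q Z) (C' : CSSCode X' Q' Z')
    (G₁ : Gadget C) (G₂ : Gadget C')
    (h₁ : G₁.DistancePreserving) (h₂ : G₂.DistancePreserving) :
    (max C.distX C'.distX ≤ (G₁.inheritFirst X' Q' Z').faultDistX (C.middleSector C') ∧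
      max C.distZ C'.distZ ≤ (G₁.inheritFirst X' Q' Z').faultDistZ (C.middleSector C')) ∧
    (max C.distX C'.distX ≤ (G₂.inheritSecond X Q Z).faultDistX (C.middleSector C') ∧
      max C.distZ C'.distZ ≤ (G₂.inheritSecond X Q Z).faultDistZ (C.middleSector C')) := by
  refine ⟨⟨le_iInf₂ fun f hf => ?_, le_iInf₂ fun f hf => ?_⟩,
    ⟨le_iInf₂ fun f hf => ?_, le_iInf₂ fun f hf => ?_⟩⟩
  · obtain ⟨⟨b, hb⟩, ⟨a, ha⟩⟩ := hf.exists_contraction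
    obtain ⟨g, hg, hgc⟩ := G₁.inheritFirst_projectsTo.exists_outputError_eq f
    exact (max_distX_le_faultCount h₁ (by rw [hg]; exact hb) (by rw [hg]; exact ha)).trans
      (Nat.cast_le.2 hgc)
  · obtain ⟨⟨b, hb⟩, ⟨a, ha⟩⟩ := hf.exists_contraction
    obtain ⟨g, hg, hgc⟩ := G₁.inheritFirst_projectsTo.exists_outputError_eq f
    exact (max_distZ_le_faultCount h₁ (by rw [hg]; exact hb) (by rw [hg]; exact ha)).trans
      (Nat.cast_le.2 hgc)
  · obtain ⟨⟨b, hb⟩, ⟨a, ha⟩⟩ := hf.exists_contraction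
    obtain ⟨g, hg, hgc⟩ := G₂.inheritSecond_projectsTo.exists_outputError_eq f
    -- Transposing the grid exchanges the two codes.
    rw [max_comm]
    exact (max_distX_le_faultCount h₂ (by rw [hg]; exact ha) (by rw [hg]; exact hb)).trans
      (Nat.cast_le.2 hgc)
  · obtain ⟨⟨b, hb⟩, ⟨a, ha⟩⟩ := hf.exists_contraction
    obtain ⟨g, hg, hgc⟩ := G₂.inheritSecond_projectsTo.exists_outputError_eq f
    rw [max_comm]
    exact (max_distZ_le_faultCount h₂ (by rw [hg]; exact ha) (by rw [hg]; exact hb)).trans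
      (Nat.cast_le.2 hgc)
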